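/- A circle representation of a multigraph $G$ is a collection of circles of positive radius in the Euclidean plane $\mathbb R^2$ such that every point of the plane lies on at most two of the circles, together with a bijection from the vertices of $G$ onto the set of points that lie on exactly two of the circles, and a bijection from the edges of $G$ onto the set of circular arcs into which these points divide the circles, such that the arc assigned to an edge joins the points assigned to the two ends of that edge. (Touching points and crossing points of circles are both allowed; a circle containing exactly one of the points gives one arc, from that point to itself, and a circle containing none gives no arc.) A multigraph is circle representable if it has a circle representation. Let $M$ be the following ($4$-regular, planar) multigraph with the $12$ vertices $v_1,\dots,v_8,w_1,w_2,w_3,w_4$ and $24$ edges: the eight edges of the cycle $v_1v_2\cdots v_8v_1$, and, for each of the four pairs $(v_1,v_4)$, $(v_2,v_7)$, $(v_3,v_6)$, $(v_5,v_8)$ with associated vertex $w_1$, $w_2$, $w_3$, $w_4$ respectively, two parallel edges from each of the two vertices of the pair to the associated vertex $w_j$. Theorem. The multigraph $M$ is not circle representable. -/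

import Mathlib

open scoped Graph

/-- A circle in the Euclidean plane, the plane being `ℂ`. Positivity of the radius is imposed in
`CircleRepresentation`. -/
abbrev PlaneCircle : Type := EuclideanGeometry.Sphere ℂ

/-- The nodes of a collection of circles: the points lying on exactly two circles of the
collection (touching points and crossing points). -/
def nodes (𝒞 : Set PlaneCircle) : Set ℂ :=
  {p | {C ∈ 𝒞 | p ∈ C}.encard = 2}

/-- `A` is one of the circular arcs into which the nodes of the collection `𝒞` divide its circles,
and it runs counterclockwise from the node `x` to the node `y`. The arc is taken without its end
points and contains no node. A circle with exactly one node `x` contributes the single arc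
`C \ {x}`, from `x` to `x` (`b = a + 2π`); a circle without nodes contributes no arc. -/
def IsArc (𝒞 : Set PlaneCircle) (A : Set ℂ) (x y : ℂ) : Prop :=
  ∃ C ∈ 𝒞, ∃ a b : ℝ, a < b ∧ b ≤ a + 2 * Real.pi ∧
    circleMap C.center C.radius a = x ∧ circleMap C.center C.radius b = y ∧
    x ∈ nodes 𝒞 ∧ y ∈ nodes 𝒞 ∧
    A = circleMap C.center C.radius '' Set.Ioo a b ∧
    Disjoint A (nodes 𝒞)

/-- A circle representation of a multigraph `G`: a collection of circles in the plane such that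
every point lies on at most two of them, together with a bijection from the vertices onto the
points lying on exactly two of them and a bijection from the edges onto the circular arcs between
those points, such that the arc of an edge joins the points of the two ends of the edge. -/
structure CircleRepresentation {α β : Type*} (G : Graph α β) where
  circles : Set PlaneCircle
  radius_pos : ∀ C ∈ circles, 0 < C.radius
  at_most_two : ∀ p : ℂ, {C ∈ circles | p ∈ C}.encard ≤ 2
  point : α → ℂ
  point_bijOn : Set.BijOn point V(G) (nodes circles)
  arc : β → Set ℂ
  arc_bijOn : Set.BijOn arc E(G) {A | ∃ x y, IsArc circles A x y}
  arc_ends : ∀ e x y, G.IsLink e x y →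
    IsArc circles (arc e) (point x) (point y) ∨ IsArc circles (arc e) (point y) (point x)

/-- `G` is circle representable if it admits a circle representation. -/
def CircleRepresentable {α β : Type*} (G : Graph α β) : Prop :=
  Nonempty (CircleRepresentation G)

/-- The twelve vertices of the multigraph `M`: `v i` is `v_{i+1}`, and each `w j` is the common
vertex of a pair of neighbouring digons. -/
inductive MVertex
  | v (i : Fin 8)
  | w (j : Fin 4)
  deriving DecidableEq, Fintype

/-- The edges of `M`: the edges of the 8-cycle, and two parallel edges (a digon) for each `v i`. -/
inductive MEdge
  | cycle (i : Fin 8)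
  | digon (i : Fin 8) (b : Bool)
  deriving DecidableEq, Fintype

/-- The vertex shared by the digon at `v i` and its neighbouring digon. The neighbouring pairs are
attached at `(v₁, v₄)`, `(v₂, v₇)`, `(v₃, v₆)` and `(v₅, v₈)`. -/
def mHub : Fin 8 → Fin 4 := ![0, 1, 2, 0, 3, 2, 1, 3]

/-- The two ends of an edge of `M`. -/
def mEnds : MEdge → Sym2 MVertex
  | .cycle i => s(.v i, .v (i + 1))
  | .digon i _ => s(.v i, .w (mHub i))

/-- The multigraph `M`. -/
def multigraphM : Graph MVertex MEdge where
  vertexSet := Set.univ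
  edgeSet := Set.univ
  IsLink e x y := mEnds e = s(x, y)
  isLink_symm e _ := ⟨fun x y h => h.trans Sym2.eq_swap⟩
  eq_or_eq_of_isLink_of_isLink e x y v w h h' := by
    have h2 : s(x, y) = s(v, w) := h.symm.trans h'
    rcases Sym2.eq_iff.1 h2 with ⟨h3, _⟩ | ⟨h3, _⟩
    · exact Or.inl h3
    · exact Or.inr h3
  edge_mem_iff_exists_isLink e := by
    refine ⟨fun _ => ?_, fun _ => Set.mem_univ e⟩
    cases e with
    | cycle i => exact ⟨_, _, rfl⟩
    | digon i b => exact ⟨_, _, rfl⟩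
  left_mem_of_isLink _ _ _ _ := Set.mem_univ _

open ComplexConjugate in
/-- If two distinct circles meet in a single point `v`, then `v` lies on the line of centers. -/
theorem exists_center_sub_eq_of_unique_common {C D : PlaneCircle} {v : ℂ} (hpos : 0 < C.radius)
    (hne : C ≠ D) (hC : v ∈ C) (hD : v ∈ D) (huniq : ∀ q, q ∈ C → q ∈ D → q = v) :
    ∃ l : ℝ, D.center - C.center = l * (v - C.center) := by
  obtain ⟨o, R⟩ := C
  obtain ⟨c, r⟩ := D
  simp only [EuclideanGeometry.mem_sphere, dist_eq_norm] at *
  have hco : c - o ≠ 0 := by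
    intro h
    have h' : c = o := sub_eq_zero.1 h
    subst h'
    exact hne (by rw [← hC, ← hD])
  have hcc : conj (c - o) ≠ 0 := (map_ne_zero _).2 hco
  have hn : ‖(c - o) / conj (c - o)‖ = 1 := by
    rw [norm_div, Complex.norm_conj, div_self (norm_ne_zero_iff.2 hco)]
  have hvo : v - o ≠ 0 := by
    rw [← norm_pos_iff, hC]
    exact hpos
  have key := huniq (o + (c - o) / conj (c - o) * conj (v - o)) ?_ ?_
  · have h1 : (c - o) * conj (v - o) = (v - o) * conj (c - o) := by
      have : (c - o) / conj (c - o) * conj (v - o) = v - o := by linear_combination key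
      rw [div_mul_eq_mul_div, div_eq_iff hcc] at this
      exact this
    have h2 : conj ((c - o) * conj (v - o)) = (c - o) * conj (v - o) := by
      rw [map_mul, Complex.conj_conj, h1]
      ring
    obtain ⟨x, hx⟩ := Complex.conj_eq_iff_real.1 h2
    refine ⟨x / Complex.normSq (v - o), ?_⟩
    have h3 : conj (v - o) ≠ 0 := (map_ne_zero _).2 hvo
    push_cast
    rw [← hx, Complex.normSq_eq_conj_mul_self]
    field_simp
  · rw [add_sub_cancel_left, norm_mul, hn, one_mul, Complex.norm_conj, hC]
  · have : o + (c - o) / conj (c - o) * conj (v - o) - c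
        = (c - o) / conj (c - o) * conj (v - c) := by
      field_simp
      simp only [map_sub]
      ring
    rw [this, norm_mul, hn, one_mul, Complex.norm_conj, hD]

theorem exists_common_point {C D : PlaneCircle} (hC : 0 < C.radius) (hD : 0 < D.radius)
    (h : (dist C.center D.center ^ 2) ^ 2
      - 2 * dist C.center D.center ^ 2 * (C.radius ^ 2 + D.radius ^ 2)
      + (C.radius ^ 2 - D.radius ^ 2) ^ 2 ≤ 0) : ∃ q, q ∈ C ∧ q ∈ D := by
  obtain ⟨o, R⟩ := C
  obtain ⟨c, r⟩ := D
  simp only [EuclideanGeometry.mem_sphere, dist_eq_norm] at *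
  have hd : ‖o - c‖ ^ 2 = (o.re - c.re) ^ 2 + (o.im - c.im) ^ 2 := by
    rw [← Complex.normSq_eq_norm_sq, Complex.normSq_apply]; simp; ring
  have hnorm : ∀ (z : ℂ) (t : ℝ), 0 < t → z.re ^ 2 + z.im ^ 2 = t ^ 2 → ‖z‖ = t := by
    intro z t ht hz
    have : ‖z‖ ^ 2 = t ^ 2 := by
      rw [← Complex.normSq_eq_norm_sq, Complex.normSq_apply]; linarith
    exact (pow_left_inj₀ (norm_nonneg _) ht.le two_ne_zero).1 this
  set d := ‖o - c‖ ^ 2 with hddef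
  rcases (sq_nonneg ‖o - c‖).eq_or_lt with h0 | h0
  · rw [← hddef] at h0
    rw [← h0] at h
    have h1 : R ^ 2 - r ^ 2 = 0 := by
      have : (R ^ 2 - r ^ 2) ^ 2 = 0 := le_antisymm (by linarith) (sq_nonneg _)
      exact pow_eq_zero_iff two_ne_zero |>.1 this
    have h2 : R = r := (pow_left_inj₀ hC.le hD.le two_ne_zero).1 (by linarith)
    have h3 : o = c := by
      have : ‖o - c‖ = 0 := pow_eq_zero_iff two_ne_zero |>.1 h0.symm
      exact sub_eq_zero.1 (norm_eq_zero.1 this)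
    refine ⟨o + R, ?_, ?_⟩
    · simp [abs_of_pos hC]
    · simp [h3, ← h2, abs_of_pos hC]
  · rw [← hddef] at h0
    set s := (d + R ^ 2 - r ^ 2) / (2 * d) with hs
    have hsd : 2 * d * s = d + R ^ 2 - r ^ 2 := by rw [hs]; field_simp
    have hpos : 0 ≤ R ^ 2 / d - s ^ 2 := by
      have : R ^ 2 / d - s ^ 2 = (4 * d * R ^ 2 - (2 * d * s) ^ 2) / (4 * d ^ 2) := by
        field_simp; ring
      rw [this, hsd]
      apply div_nonneg _ (by positivity)
      nlinarith
    have ht := Real.sq_sqrt hpos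
    set t := √(R ^ 2 / d - s ^ 2)
    have hst : d * (s ^ 2 + t ^ 2) = R ^ 2 := by
      rw [ht]; clear_value s d; field_simp; ring
    refine ⟨⟨o.re + (s * (c.re - o.re) - t * (c.im - o.im)),
      o.im + (s * (c.im - o.im) + t * (c.re - o.re))⟩, hnorm _ _ hC ?_, hnorm _ _ hD ?_⟩
    · simp only [Complex.sub_re, Complex.sub_im]
      rw [← hst, hd]; ring
    · simp only [Complex.sub_re, Complex.sub_im]
      have : r ^ 2 = d * ((s - 1) ^ 2 + t ^ 2) := by linear_combination hsd - hst
      rw [this, hd]; ring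

theorem discriminant_eq_zero_of_unique_common {C D : PlaneCircle} {v : ℂ} (hpos : 0 < C.radius)
    (hne : C ≠ D) (hC : v ∈ C) (hD : v ∈ D) (huniq : ∀ q, q ∈ C → q ∈ D → q = v) :
    (dist C.center D.center ^ 2) ^ 2
      - 2 * dist C.center D.center ^ 2 * (C.radius ^ 2 + D.radius ^ 2)
      + (C.radius ^ 2 - D.radius ^ 2) ^ 2 = 0 := by
  obtain ⟨l, hl⟩ := exists_center_sub_eq_of_unique_common hpos hne hC hD huniq
  obtain ⟨o, R⟩ := C
  obtain ⟨c, r⟩ := D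
  simp only [EuclideanGeometry.mem_sphere, dist_eq_norm] at *
  have h1 : ‖o - c‖ ^ 2 = l ^ 2 * R ^ 2 := by
    rw [← neg_sub, norm_neg, hl, norm_mul, hC, mul_pow, Complex.norm_real, Real.norm_eq_abs, sq_abs]
  have h2 : r ^ 2 = (1 - l) ^ 2 * R ^ 2 := by
    have : v - c = ((1 - l : ℝ) : ℂ) * (v - o) := by
      push_cast; linear_combination -hl
    rw [← hD, this, norm_mul, hC, mul_pow, Complex.norm_real, Real.norm_eq_abs, sq_abs]
  rw [h1, h2]; ring

/-- The discriminant of two circles that touch a common circle, in terms of the position of their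
centers on the radii of that circle. -/
theorem discriminant_of_centers_on_radii {o : ℂ} {R a b l m : ℝ} {C D : PlaneCircle}
    (hCv : circleMap o R a ∈ C) (hDv : circleMap o R b ∈ D)
    (hC : C.center - o = l * (circleMap o R a - o))
    (hD : D.center - o = m * (circleMap o R b - o)) :
    (dist C.center D.center ^ 2) ^ 2
      - 2 * dist C.center D.center ^ 2 * (C.radius ^ 2 + D.radius ^ 2)
      + (C.radius ^ 2 - D.radius ^ 2) ^ 2 =
    16 * R ^ 4 * (l * m * Real.sin ((b - a) / 2) ^ 2) *
      (l * m * Real.sin ((b - a) / 2) ^ 2 - (1 - l) * (1 - m)) := by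
  obtain ⟨c, r⟩ := C
  obtain ⟨d, s⟩ := D
  simp only [EuclideanGeometry.mem_sphere, dist_eq_norm] at *
  have hrad : ∀ (t p q : ℝ) (z : ℂ), z - o = t * (circleMap o R p - o) →
      ‖circleMap o R p - z‖ = q → q ^ 2 = (1 - t) ^ 2 * R ^ 2 := by
    intro t p q z hz hq
    have : circleMap o R p - z = ((1 - t : ℝ) : ℂ) * (circleMap o R p - o) := by
      push_cast; linear_combination -hz
    rw [← hq, this, norm_mul, circleMap_sub_center, norm_circleMap_zero, mul_pow,
      Complex.norm_real, Real.norm_eq_abs, sq_abs, sq_abs]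
  rw [hrad _ _ _ _ hC hCv, hrad _ _ _ _ hD hDv]
  have hd : ‖c - d‖ ^ 2 =
      (l - m) ^ 2 * R ^ 2 + 4 * l * m * R ^ 2 * Real.sin ((b - a) / 2) ^ 2 := by
    have h1 : c - d = l * circleMap 0 R a - m * circleMap 0 R b := by
      rw [circleMap_sub_center] at hC hD
      linear_combination hC - hD
    have h2 : Real.sin ((b - a) / 2) ^ 2 = 1 / 2 - (Real.cos b * Real.cos a +
        Real.sin b * Real.sin a) / 2 := by
      rw [Real.sin_sq_eq_half_sub, mul_div_cancel₀ _ two_ne_zero, Real.cos_sub]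
    rw [h1, ← Complex.normSq_eq_norm_sq, Complex.normSq_apply, h2]
    simp only [Complex.sub_re, Complex.sub_im, Complex.re_ofReal_mul, Complex.im_ofReal_mul,
      circleMap_zero_re, circleMap_zero_im]
    linear_combination l ^ 2 * R ^ 2 * (Real.sin_sq_add_cos_sq a) +
      m ^ 2 * R ^ 2 * (Real.sin_sq_add_cos_sq b)
  rw [hd]; ring

theorem sin_sub_ptolemy (a b c d : ℝ) :
    Real.sin (c - a) * Real.sin (d - b) =
      Real.sin (b - a) * Real.sin (d - c) + Real.sin (d - a) * Real.sin (c - b) := by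
  simp only [Real.sin_sub]
  ring

/-- Two tangent pairs `a, b` and `c, d` among four circles touching a common circle from the same
side, with `a, c` and `b, d` disjoint: the products of the half-angle sines are compared. -/
theorem lt_of_tangent_of_disjoint {ka kb kc kd ab cd ac bd : ℝ} (hac : 0 < ac) (hbd : 0 < bd)
    (h1 : ka * kb * ab ^ 2 = 1) (h2 : kc * kd * cd ^ 2 = 1)
    (h3 : 1 < ka * kc * ac ^ 2) (h4 : 1 < kb * kd * bd ^ 2) : ab * cd < ac * bd := by
  have hk : 0 < ka * kb * (kc * kd) := by
    have : 0 < ka * kb := by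
      by_contra! h
      nlinarith [sq_nonneg ab]
    have : 0 < kc * kd := by
      by_contra! h
      nlinarith [sq_nonneg cd]
    positivity
  have h5 : 1 < ka * kc * ac ^ 2 * (kb * kd * bd ^ 2) := one_lt_mul_of_lt_of_le h3 h4.le
  have h6 : ka * kb * (kc * kd) * (ab * cd) ^ 2 < ka * kb * (kc * kd) * (ac * bd) ^ 2 := by
    linear_combination h5 + h1 * (kc * kd * cd ^ 2) + h2
  exact lt_of_pow_lt_pow_left₀ 2 (by positivity) (lt_of_mul_lt_mul_left h6 hk.le)

/-- Two disjoint pairs of tangent circles, touching a common circle at the pairwise crossing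
positions `a < b < c < d`, lie on different sides of that circle. -/
theorem neg_of_crossing {a b c d ka kb kc kd : ℝ} (hab : a < b) (hbc : b < c) (hcd : c < d)
    (hda : d < a + Real.pi)
    (hac : ka * kc * Real.sin (c - a) ^ 2 = 1) (hbd : kb * kd * Real.sin (d - b) ^ 2 = 1)
    (h1 : ka * kb * Real.sin (b - a) ^ 2 < 0 ∨ 1 < ka * kb * Real.sin (b - a) ^ 2)
    (h2 : kc * kd * Real.sin (d - c) ^ 2 < 0 ∨ 1 < kc * kd * Real.sin (d - c) ^ 2) :
    ka * kb < 0 := by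
  by_contra! hk
  have hk1 : 0 < ka * kc := by
    by_contra! h
    nlinarith [sq_nonneg (Real.sin (c - a))]
  have hk2 : 0 < kb * kd := by
    by_contra! h
    nlinarith [sq_nonneg (Real.sin (d - b))]
  have hk3 : 0 ≤ kc * kd := by
    refine nonneg_of_mul_nonneg_right (a := ka * kb) ?_ ?_
    · calc 0 ≤ ka * kc * (kb * kd) := by positivity
        _ = _ := by ring
    · refine hk.lt_of_ne' (mul_ne_zero ?_ ?_)
      · rintro rfl; simp at hk1
      · rintro rfl; simp at hk2
  have h1' := h1.resolve_left (not_lt.2 (by positivity))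
  have h2' := h2.resolve_left (not_lt.2 (by positivity))
  have s1 : 0 < Real.sin (b - a) := Real.sin_pos_of_pos_of_lt_pi (by linarith) (by linarith)
  have s2 : 0 < Real.sin (d - c) := Real.sin_pos_of_pos_of_lt_pi (by linarith) (by linarith)
  have s3 : 0 < Real.sin (d - a) := Real.sin_pos_of_pos_of_lt_pi (by linarith) (by linarith)
  have s4 : 0 < Real.sin (c - b) := Real.sin_pos_of_pos_of_lt_pi (by linarith) (by linarith)
  have := lt_of_tangent_of_disjoint s1 s2 hac hbd h1' h2'
  rw [sin_sub_ptolemy] at this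
  nlinarith [mul_pos s3 s4]

/-- Monotonicity of the cross-ratio. -/
theorem sin_cross_ratio_le {p1 p2 p3 p4 p5 p6 p7 p8 : ℝ} (h12 : p1 < p2) (h23 : p2 < p3)
    (h34 : p3 < p4) (h45 : p4 < p5) (h56 : p5 < p6) (h67 : p6 < p7) (h78 : p7 < p8)
    (h81 : p8 < p1 + Real.pi) :
    Real.sin (p8 - p1) * Real.sin (p5 - p4) * (Real.sin (p3 - p2) * Real.sin (p7 - p6)) ≤
    Real.sin (p4 - p1) * Real.sin (p8 - p5) * (Real.sin (p7 - p2) * Real.sin (p6 - p3)) := by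
  have pos : ∀ {x y : ℝ}, p1 ≤ x → x < y → y ≤ p8 → 0 < Real.sin (y - x) := fun _ _ _ =>
    Real.sin_pos_of_pos_of_lt_pi (by linarith) (by linarith)
  have le : ∀ {a b c d : ℝ}, p1 ≤ a → a < b → b < c → c < d → d ≤ p8 →
      Real.sin (d - a) * Real.sin (c - b) ≤ Real.sin (c - a) * Real.sin (d - b) := by
    intro a b c d ha hab hbc hcd hd
    rw [sin_sub_ptolemy a b c d]
    have := mul_pos (pos ha hab (by linarith)) (pos (by linarith) hcd hd)
    linarith
  have le' : ∀ {a b c d : ℝ}, p1 ≤ a → a < b → b < c → c < d → d ≤ p8 →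
      Real.sin (b - a) * Real.sin (d - c) ≤ Real.sin (c - a) * Real.sin (d - b) := by
    intro a b c d ha hab hbc hcd hd
    rw [sin_sub_ptolemy a b c d]
    have := mul_pos (pos ha (by linarith) hd) (pos (by linarith) hbc (by linarith))
    linarith
  have s14 := pos (x := p1) (y := p4) (by linarith) (by linarith) (by linarith)
  have s58 := pos (x := p5) (y := p8) (by linarith) (by linarith) (by linarith)
  have s45 := pos (x := p4) (y := p5) (by linarith) (by linarith) (by linarith)
  have s23 := pos (x := p2) (y := p3) (by linarith) (by linarith) (by linarith)
  have s67 := pos (x := p6) (y := p7) (by linarith) (by linarith) (by linarith)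
  have s24 := pos (x := p2) (y := p4) (by linarith) (by linarith) (by linarith)
  have s28 := pos (x := p2) (y := p8) (by linarith) (by linarith) (by linarith)
  have s57 := pos (x := p5) (y := p7) (by linarith) (by linarith) (by linarith)
  have s27 := pos (x := p2) (y := p7) (by linarith) (by linarith) (by linarith)
  have s35 := pos (x := p3) (y := p5) (by linarith) (by linarith) (by linarith)
  have m1 := le (a := p1) (b := p2) (c := p4) (d := p8) le_rfl h12 (by linarith) (by linarith)
    le_rfl
  have m2 := le (a := p2) (b := p5) (c := p7) (d := p8) h12.le (by linarith) (by linarith) h78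
    le_rfl
  have m3 := le' (a := p2) (b := p3) (c := p4) (d := p5) h12.le h23 h34 h45 (by linarith)
  have m4 := le' (a := p3) (b := p5) (c := p6) (d := p7) (by linarith) (by linarith) h56 h67
    h78.le
  have m := mul_le_mul (mul_le_mul m1 m2 (by positivity) (by positivity))
    (mul_le_mul m3 m4 (by positivity) (by positivity)) (by positivity) (by positivity)
  have hpos : 0 < Real.sin (p4 - p2) * Real.sin (p8 - p2) * Real.sin (p7 - p5) *
    Real.sin (p5 - p3) := by positivity
  refine le_of_mul_le_mul_left ?_ hpos
  linear_combination m

theorem exists_ne_mHub_eq : ∀ i : Fin 8, ∃ j, i ≠ j ∧ mHub i = mHub j := by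
  decide

theorem mHub_configuration_false {p k : Fin 8 → ℝ} (hp : StrictMono p)
    (hlt : p 7 < p 0 + Real.pi)
    (htan : ∀ i j, i ≠ j → mHub i = mHub j → k i * k j * Real.sin (p j - p i) ^ 2 = 1)
    (hdis : ∀ i j, mHub i ≠ mHub j → k i * k j * Real.sin (p j - p i) ^ 2 < 0 ∨
      1 < k i * k j * Real.sin (p j - p i) ^ 2) : False := by
  have l01 : p 0 < p 1 := hp (by decide)
  have l12 : p 1 < p 2 := hp (by decide)
  have l23 : p 2 < p 3 := hp (by decide)
  have l34 : p 3 < p 4 := hp (by decide)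
  have l45 : p 4 < p 5 := hp (by decide)
  have l56 : p 5 < p 6 := hp (by decide)
  have l67 : p 6 < p 7 := hp (by decide)
  have t03 := htan 0 3 (by decide) (by decide)
  have t16 := htan 1 6 (by decide) (by decide)
  have t25 := htan 2 5 (by decide) (by decide)
  have t47 := htan 4 7 (by decide) (by decide)
  have n01 : k 0 * k 1 < 0 := neg_of_crossing (by linarith) (by linarith) (by linarith)
    (by linarith) t03 t16 (hdis 0 1 (by decide)) (hdis 3 6 (by decide))
  have n02 : k 0 * k 2 < 0 := neg_of_crossing (by linarith) (by linarith) (by linarith)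
    (by linarith) t03 t25 (hdis 0 2 (by decide)) (hdis 3 5 (by decide))
  have n14 : k 1 * k 4 < 0 := neg_of_crossing (by linarith) (by linarith) (by linarith)
    (by linarith) t16 t47 (hdis 1 4 (by decide)) (hdis 6 7 (by decide))
  have same : ∀ {x y z : ℝ}, x * y < 0 → x * z < 0 → 0 ≤ y * z := by
    intro x y z hy hz
    have h := mul_pos_of_neg_of_neg hy hz
    have hx : 0 < x ^ 2 := by
      apply sq_pos_of_ne_zero
      rintro rfl
      simp at hy
    exact (pos_of_mul_pos_right (a := x ^ 2) (by linear_combination h) hx.le).le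
  have tpos : ∀ i j, i ≠ j → mHub i = mHub j → 0 < k i * k j := by
    intro i j hij h
    by_contra! h'
    nlinarith [htan i j hij h, sq_nonneg (Real.sin (p j - p i))]
  have c03 := tpos 0 3 (by decide) (by decide)
  have c16 := tpos 1 6 (by decide) (by decide)
  have c25 := tpos 2 5 (by decide) (by decide)
  have c47 := tpos 4 7 (by decide) (by decide)
  have q12 : 0 ≤ k 1 * k 2 := same n01 n02
  have q04 : 0 ≤ k 0 * k 4 := same (x := k 1) (by linarith [mul_comm (k 0) (k 1)]) n14
  have q0 : ∀ i, k i ≠ 0 := by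
    intro i h
    obtain ⟨j, hij, hj⟩ := exists_ne_mHub_eq i
    have := tpos i j hij hj
    simp [h] at this
  have pos : ∀ i j, i < j → 0 < Real.sin (p j - p i) := fun i j hij => by
    have h1 := hp hij
    have h2 : p j ≤ p 7 := hp.monotone (by omega)
    have h3 : p 0 ≤ p i := hp.monotone (by omega)
    exact Real.sin_pos_of_pos_of_lt_pi (by linarith) (by linarith)
  have far : ∀ i j, mHub i ≠ mHub j → 0 ≤ k i * k j →
      1 < k i * k j * Real.sin (p j - p i) ^ 2 := fun i j h h' =>
    (hdis i j h).resolve_left (not_lt.2 (by positivity))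
  have q65 : 0 ≤ k 6 * k 5 :=
    (pos_of_mul_pos_right (a := k 1 * k 2) (by linear_combination mul_pos c16 c25) q12).le
  have q34 : 0 ≤ k 3 * k 4 := by
    have h : 0 ≤ k 0 ^ 2 * (k 3 * k 4) := by
      have := mul_nonneg c03.le q04
      linear_combination this
    exact nonneg_of_mul_nonneg_right h (sq_pos_of_ne_zero (q0 0))
  have q07 : 0 ≤ k 0 * k 7 := by
    have h : 0 ≤ k 4 ^ 2 * (k 0 * k 7) := by
      have := mul_nonneg c47.le q04
      linear_combination this
    exact nonneg_of_mul_nonneg_right h (sq_pos_of_ne_zero (q0 4))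
  have t74 : k 7 * k 4 * Real.sin (p 7 - p 4) ^ 2 = 1 := by rw [mul_comm (k 7), t47]
  have e1 := lt_of_tangent_of_disjoint (pos 0 7 (by decide)) (pos 3 4 (by decide)) t03 t74
    (far 0 7 (by decide) q07) (far 3 4 (by decide) q34)
  have e2 := lt_of_tangent_of_disjoint (pos 1 2 (by decide)) (pos 5 6 (by decide)) t16
    (kc := k 2) (kd := k 5) t25 (far 1 2 (by decide) q12)
    (by rw [mul_comm (k 6)]; exact far 5 6 (by decide) (by linarith))
  have := sin_cross_ratio_le l01 l12 l23 l34 l45 l56 l67 hlt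
  have := mul_lt_mul'' e1 e2
    (by have := pos 0 3 (by decide); have := pos 4 7 (by decide); positivity)
    (by have := pos 1 6 (by decide); have := pos 2 5 (by decide); positivity)
  linarith

/-- `A` is an arc of the circle `C` running counterclockwise from `x` to `y`, with end points in
`N` and no interior point in `N`. -/
def ArcOn (N : Set ℂ) (C : PlaneCircle) (A : Set ℂ) (x y : ℂ) : Prop :=
  ∃ a b : ℝ, a < b ∧ b ≤ a + 2 * Real.pi ∧
    circleMap C.center C.radius a = x ∧ circleMap C.center C.radius b = y ∧
    x ∈ N ∧ y ∈ N ∧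
    A = circleMap C.center C.radius '' Set.Ioo a b ∧
    Disjoint A N

theorem isArc_iff_exists_arcOn {𝒞 : Set PlaneCircle} {A : Set ℂ} {x y : ℂ} :
    IsArc 𝒞 A x y ↔ ∃ C ∈ 𝒞, ArcOn (nodes 𝒞) C A x y :=
  Iff.rfl

theorem exists_common_parameter {c : ℂ} {R a a' : ℝ} (hR : R ≠ 0)
    (h : circleMap c R a' = circleMap c R a) :
    ∃ s : ℝ, a = a' + s ∧ ∀ t, circleMap c R (t + s) = circleMap c R t := by
  obtain ⟨n, hn⟩ := (circleMap_eq_circleMap_iff c hR).1 h.symm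
  refine ⟨n * (2 * Real.pi), ?_, fun t => (periodic_circleMap c R).int_mul n t⟩
  have : ((a : ℂ)) = ((a' + n * (2 * Real.pi) : ℝ) : ℂ) := by
    apply mul_right_cancel₀ Complex.I_ne_zero
    push_cast
    linear_combination hn
  exact_mod_cast this

theorem image_Ioo_add_period {c : ℂ} {R s : ℝ}
    (h : ∀ t, circleMap c R (t + s) = circleMap c R t) (a b : ℝ) :
    circleMap c R '' Set.Ioo (a + s) (b + s) = circleMap c R '' Set.Ioo a b := by
  rw [← Set.image_add_const_Ioo, Set.image_image]
  simp only [h]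

namespace ArcOn

variable {N : Set ℂ} {C : PlaneCircle} {A A' : Set ℂ} {x y z : ℂ}

theorem left_mem (hC : 0 < C.radius) (h : ArcOn N C A x y) : x ∈ C := by
  obtain ⟨a, b, -, -, rfl, -⟩ := h
  exact circleMap_mem_sphere _ hC.le _

theorem right_mem (hC : 0 < C.radius) (h : ArcOn N C A x y) : y ∈ C := by
  obtain ⟨a, b, -, -, -, rfl, -⟩ := h
  exact circleMap_mem_sphere _ hC.le _

/-- The continuation of a given parameter of the start point to one of the end point. -/
theorem exists_continuation (hC : 0 < C.radius) (h : ArcOn N C A x y) {t : ℝ}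
    (ht : circleMap C.center C.radius t = x) :
    ∃ t', t < t' ∧ t' ≤ t + 2 * Real.pi ∧ circleMap C.center C.radius t' = y ∧
      A = circleMap C.center C.radius '' Set.Ioo t t' ∧
      ∀ u ∈ Set.Ioo t t', circleMap C.center C.radius u ∉ N := by
  obtain ⟨a, b, hab, hb, hx, hy, -, -, rfl, hd⟩ := h
  obtain ⟨s, rfl, hs⟩ := exists_common_parameter hC.ne' (hx.trans ht.symm)
  have him := image_Ioo_add_period hs a b
  refine ⟨b + s, by linarith, by linarith, by rw [hs, hy], him.symm, fun u hu huN => ?_⟩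
  rw [← him] at hd
  exact hd.notMem_of_mem_left (Set.mem_image_of_mem _ hu) huN

theorem eq_of_left (hC : 0 < C.radius) (h : ArcOn N C A x y) (h' : ArcOn N C A' x z) :
    A = A' := by
  obtain ⟨t, -, -, -, ht, -⟩ := id h
  obtain ⟨b, hb, -, hby, hA, hd⟩ := h.exists_continuation hC ht
  obtain ⟨b', hb', -, hby', hA', hd'⟩ := h'.exists_continuation hC ht
  obtain ⟨-, -, -, -, -, -, -, hy, -⟩ := h
  obtain ⟨-, -, -, -, -, -, -, hz, -⟩ := h'
  rcases lt_trichotomy b b' with hlt | rfl | hlt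
  · exact absurd (hby ▸ hy) (hd' b ⟨hb, hlt⟩)
  · rw [hA, hA']
  · exact absurd (hby' ▸ hz) (hd b' ⟨hb', hlt⟩)

theorem eq_of_right (hC : 0 < C.radius) (h : ArcOn N C A x z) (h' : ArcOn N C A' y z) :
    A = A' := by
  obtain ⟨a, b, hab, -, hx, hz, hxN, -, rfl, hd⟩ := h
  obtain ⟨a', b', hab', -, hy, hz', hyN, -, rfl, hd'⟩ := h'
  obtain ⟨s, rfl, hs⟩ := exists_common_parameter hC.ne' (hz'.trans hz.symm)
  have him := image_Ioo_add_period hs a' b'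
  rcases lt_trichotomy a (a' + s) with hlt | rfl | hlt
  · exact absurd (hy ▸ hyN) (hd.notMem_of_mem_left ⟨_, ⟨hlt, by linarith⟩, hs a'⟩)
  · exact him
  · rw [← him] at hd'
    exact absurd (hx ▸ hxN) (hd'.notMem_of_mem_left ⟨a, ⟨hlt, hab⟩, rfl⟩)

/-- Consecutive arcs are parametrized by consecutive intervals. -/
theorem exists_parametrization (hC : 0 < C.radius) {p : ℕ → ℂ} {B : ℕ → Set ℂ}
    (h : ∀ n, ArcOn N C (B n) (p n) (p (n + 1))) :
    ∃ t : ℕ → ℝ, StrictMono t ∧ (∀ n, circleMap C.center C.radius (t n) = p n) ∧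
      ∀ n, ∀ u ∈ Set.Ioo (t n) (t (n + 1)), circleMap C.center C.radius u ∉ N := by
  choose f hf using fun n (t : {t : ℝ // circleMap C.center C.radius t = p n}) =>
    (h n).exists_continuation hC t.2
  obtain ⟨a, -, -, -, ha, -⟩ := h 0
  let t : ∀ n, {t : ℝ // circleMap C.center C.radius t = p n} := fun n =>
    Nat.rec ⟨a, ha⟩ (fun n t => ⟨f n t, (hf n t).2.2.1⟩) n
  exact ⟨fun n => (t n).1, strictMono_nat_of_lt_succ fun n => (hf n (t n)).1, fun n => (t n).2,
    fun n => (hf n (t n)).2.2.2.2⟩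

/-- A path of arcs that does not return to its start runs at most once around the circle. -/
theorem parameter_lt {p : ℕ → ℂ} {t : ℕ → ℝ} (hp : p 0 ∈ N)
    (ht : ∀ n, circleMap C.center C.radius (t n) = p n)
    (hd : ∀ n, ∀ u ∈ Set.Ioo (t n) (t (n + 1)), circleMap C.center C.radius u ∉ N) {m : ℕ}
    (hm : ∀ n, 1 ≤ n → n ≤ m → p n ≠ p 0) : t m < t 0 + 2 * Real.pi := by
  have hper : circleMap C.center C.radius (t 0 + 2 * Real.pi) = p 0 := by
    rw [periodic_circleMap, ht]
  induction m with
  | zero => linarith [Real.pi_pos]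
  | succ m ih =>
    have h := ih fun n h1 h2 => hm n h1 (by omega)
    by_contra! hle
    rcases hle.eq_or_lt with heq | hlt
    · exact hm (m + 1) (by omega) le_rfl (by rw [← ht, ← heq, hper])
    · exact hd m _ ⟨h, hlt⟩ (hper ▸ hp)

/-- A circle made of two arcs contains only the two end points of these arcs. -/
theorem eq_or_eq_of_two_arcs (hC : 0 < C.radius) (h : ArcOn N C A x y)
    (h' : ArcOn N C A' y x) (hz : z ∈ C) (hzN : z ∈ N) : z = x ∨ z = y := by
  have hxN : x ∈ N := by obtain ⟨-, -, -, -, -, -, hx, -⟩ := h; exact hx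
  obtain ⟨t, -, -, -, ht, -⟩ := id h
  obtain ⟨b, hb, hb2, hby, -, hd⟩ := h.exists_continuation hC ht
  obtain ⟨e, he, -, hex, -, hd'⟩ := h'.exists_continuation hC hby
  have hle : t + 2 * Real.pi ≤ e := by
    by_contra! hlt
    refine absurd (eq_of_circleMap_eq (a := e) (b := t) (c := C.center) hC.ne' ?_
      (hex.trans ht.symm)) (by linarith)
    rw [abs_lt]
    constructor <;> linarith
  obtain ⟨u, rfl⟩ : z ∈ Set.range (circleMap C.center C.radius) := by
    rw [range_circleMap, abs_of_pos hC]
    exact hz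
  set r := toIcoMod Real.two_pi_pos t u
  have hr : circleMap C.center C.radius r = circleMap C.center C.radius u := by
    rw [show r = u - toIcoDiv Real.two_pi_pos t u • (2 * Real.pi) from rfl]
    exact (periodic_circleMap _ _).sub_zsmul_eq _
  rw [← hr] at hzN ⊢
  obtain ⟨h1, h2⟩ := toIcoMod_mem_Ico Real.two_pi_pos t u
  rcases h1.eq_or_lt with h1 | h1
  · left; rw [← ht, h1]
  rcases lt_trichotomy r b with h3 | h3 | h3
  · exact absurd hzN (hd r ⟨h1, h3⟩)
  · right; rw [h3, hby]
  · exact absurd hzN (hd' r ⟨h3, by linarith⟩)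

end ArcOn

theorem Fin.ofNat_eight_succ (n : ℕ) : Fin.ofNat 8 (n + 1) = Fin.ofNat 8 n + 1 := by
  ext
  simp [Fin.val_add]

/-- Eight circles touching the circle `C` at consecutive points cannot have the contacts prescribed
by `mHub`. -/
theorem mHub_contacts_false {N : Set ℂ} {C : PlaneCircle} {D : Fin 8 → PlaneCircle}
    {v : Fin 8 → ℂ} {B : Fin 8 → Set ℂ} (hC : 0 < C.radius) (hD : ∀ i, 0 < (D i).radius)
    (hne : ∀ i, D i ≠ C) (hv : Function.Injective v)
    (harc : ∀ i, ArcOn N C (B i) (v i) (v (i + 1)))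
    (hvD : ∀ i, v i ∈ D i) (huniq : ∀ i q, q ∈ C → q ∈ D i → q = v i)
    (htan : ∀ i j, i ≠ j → mHub i = mHub j → D i ≠ D j ∧ ∃ w, w ∈ D i ∧ w ∈ D j ∧
      ∀ q, q ∈ D i → q ∈ D j → q = w)
    (hdis : ∀ i j, mHub i ≠ mHub j → ∀ q, q ∈ D i → q ∉ D j) : False := by
  obtain ⟨t, hmono, ht, hd⟩ := ArcOn.exists_parametrization (N := N) hC
    (p := fun n : ℕ => v (Fin.ofNat 8 n)) (B := fun n : ℕ => B (Fin.ofNat 8 n)) fun n => by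
      rw [Fin.ofNat_eight_succ]
      exact harc _
  have hvN : v 0 ∈ N := by obtain ⟨-, -, -, -, -, -, hx, -⟩ := harc 0; exact hx
  have hlt : t 7 < t 0 + 2 * Real.pi := by
    refine ArcOn.parameter_lt (N := N) (by simpa using hvN) ht hd fun n h1 h2 h => ?_
    have := hv h
    interval_cases n <;> revert this <;> decide
  have hv' : ∀ i : Fin 8, circleMap C.center C.radius (t i) = v i := fun i => by
    rw [ht, Fin.ofNat_val_eq_self]
  have hmem : ∀ i, v i ∈ C := fun i => (harc i).left_mem hC
  choose l hl using fun i =>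
    exists_center_sub_eq_of_unique_common hC (hne i).symm (hmem i) (hvD i) (huniq i)
  have hl0 : ∀ i, l i ≠ 0 := by
    intro i h
    have h1 := hl i
    rw [h, Complex.ofReal_zero, zero_mul, sub_eq_zero] at h1
    refine hne i (EuclideanGeometry.Sphere.ext h1 ?_)
    have h2 := hvD i
    rw [EuclideanGeometry.mem_sphere, h1] at h2
    rw [← h2]
    exact hmem i
  have hl1 : ∀ i, 1 - l i ≠ 0 := by
    intro i h
    have h1 : l i = 1 := by linarith
    have h2 := hl i
    rw [h1, Complex.ofReal_one, one_mul, sub_left_inj] at h2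
    have h3 := hvD i
    rw [EuclideanGeometry.mem_sphere, h2, dist_self] at h3
    exact (hD i).ne h3
  have hdisc := fun i j : Fin 8 => discriminant_of_centers_on_radii (C := D i) (D := D j)
    (by rw [hv']; exact hvD i) (by rw [hv']; exact hvD j) (by rw [hv']; exact hl i)
    (by rw [hv']; exact hl j)
  have hsin : ∀ i j : Fin 8, i ≠ j → Real.sin ((t j - t i) / 2) ≠ 0 := by
    intro i j hij
    have h0 : ∀ i : Fin 8, t 0 ≤ t i ∧ t i ≤ t 7 := fun i =>
      ⟨hmono.monotone (Nat.zero_le _), hmono.monotone (by omega)⟩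
    have h1 := h0 i
    have h2 := h0 j
    rw [ne_eq, Real.sin_eq_zero_iff_of_lt_of_lt (by linarith) (by linarith)]
    intro h
    exact hij (Fin.ext (hmono.injective (by linarith)))
  refine mHub_configuration_false (p := fun i => t i / 2) (k := fun i => l i / (1 - l i))
    ?_ ?_ ?_ ?_
  · intro i j hij
    have := hmono hij
    simp only
    linarith
  · simp only [Fin.val_zero]
    have : ((7 : Fin 8) : ℕ) = 7 := rfl
    rw [this]
    linarith
  · intro i j hij h
    obtain ⟨hDne, w, hw1, hw2, hw⟩ := htan i j hij h
    have h0 := discriminant_eq_zero_of_unique_common (hD i) hDne hw1 hw2 hw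
    rw [hdisc] at h0
    have h1 := (mul_eq_zero.1 h0).resolve_left (by
      have := hl0 i; have := hl0 j; have := hsin i j hij; have := hC.ne'; positivity)
    have := hl1 i
    have := hl1 j
    rw [← sub_div]
    field_simp
    linear_combination h1
  · intro i j h
    have h0 := mt (exists_common_point (hD i) (hD j)) fun ⟨q, h1, h2⟩ => hdis i j h q h1 h2
    rw [hdisc, not_le, mul_assoc] at h0
    have h1 := pos_of_mul_pos_right h0 (by positivity)
    have hi := hl1 i
    have hj := hl1 j
    rw [← sub_div]
    set s := Real.sin ((t j - t i) / 2)
    set z := l i / (1 - l i) * (l j / (1 - l j)) * s ^ 2 with hz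
    have h2 : l i * l j * s ^ 2 = (1 - l i) * (1 - l j) * z := by
      rw [hz]
      field_simp
    rw [h2] at h1
    have h3 : 0 < z * (z - 1) := by
      refine pos_of_mul_pos_right (a := ((1 - l i) * (1 - l j)) ^ 2) ?_ (sq_nonneg _)
      linear_combination h1
    by_contra! h4
    nlinarith

namespace CircleRepresentation

variable (R : CircleRepresentation multigraphM)

theorem exists_edge_circle (e : MEdge) : ∃ C ∈ R.circles, ∀ x y, mEnds e = s(x, y) →
    ArcOn (nodes R.circles) C (R.arc e) (R.point x) (R.point y) ∨
      ArcOn (nodes R.circles) C (R.arc e) (R.point y) (R.point x) := by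
  obtain ⟨x, y, hxy⟩ : ∃ x y, mEnds e = s(x, y) := by
    cases e with
    | cycle i => exact ⟨_, _, rfl⟩
    | digon i b => exact ⟨_, _, rfl⟩
  have key : ∃ C ∈ R.circles, ArcOn (nodes R.circles) C (R.arc e) (R.point x) (R.point y) ∨
      ArcOn (nodes R.circles) C (R.arc e) (R.point y) (R.point x) := by
    rcases R.arc_ends e x y hxy with h | h
    · obtain ⟨C, hC, h⟩ := isArc_iff_exists_arcOn.1 h
      exact ⟨C, hC, Or.inl h⟩
    · obtain ⟨C, hC, h⟩ := isArc_iff_exists_arcOn.1 h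
      exact ⟨C, hC, Or.inr h⟩
  obtain ⟨C, hC, h⟩ := key
  refine ⟨C, hC, fun x' y' hxy' => ?_⟩
  rcases Sym2.eq_iff.1 (hxy.symm.trans hxy') with ⟨rfl, rfl⟩ | ⟨rfl, rfl⟩
  · exact h
  · exact h.symm

/-- The circle containing the arc of the edge `e`. -/
noncomputable def edgeCircle (e : MEdge) : PlaneCircle :=
  (R.exists_edge_circle e).choose

theorem edgeCircle_mem (e : MEdge) : R.edgeCircle e ∈ R.circles :=
  (R.exists_edge_circle e).choose_spec.1

theorem edgeCircle_radius_pos (e : MEdge) : 0 < (R.edgeCircle e).radius :=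
  R.radius_pos _ (R.edgeCircle_mem e)

theorem arcOn_edgeCircle {e : MEdge} {x y : MVertex} (h : mEnds e = s(x, y)) :
    ArcOn (nodes R.circles) (R.edgeCircle e) (R.arc e) (R.point x) (R.point y) ∨
      ArcOn (nodes R.circles) (R.edgeCircle e) (R.arc e) (R.point y) (R.point x) :=
  (R.exists_edge_circle e).choose_spec.2 x y h

theorem point_mem_edgeCircle {e : MEdge} {x y : MVertex} (h : mEnds e = s(x, y)) :
    R.point x ∈ R.edgeCircle e := by
  rcases R.arcOn_edgeCircle h with h | h
  · exact h.left_mem (R.edgeCircle_radius_pos e)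
  · exact h.right_mem (R.edgeCircle_radius_pos e)

theorem point_injective : Function.Injective R.point := fun _ _ h =>
  R.point_bijOn.injOn (Set.mem_univ _) (Set.mem_univ _) h

theorem arc_injective : Function.Injective R.arc := fun _ _ h =>
  R.arc_bijOn.injOn (Set.mem_univ _) (Set.mem_univ _) h

theorem point_mem_nodes (x : MVertex) : R.point x ∈ nodes R.circles :=
  R.point_bijOn.mapsTo (Set.mem_univ _)

theorem exists_point_eq {q : ℂ} (hq : q ∈ nodes R.circles) : ∃ x, R.point x = q := by
  obtain ⟨x, -, hx⟩ := R.point_bijOn.surjOn hq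
  exact ⟨x, hx⟩

theorem exists_two_circles (x : MVertex) : ∃ A B, ∀ C ∈ R.circles, R.point x ∈ C →
    C = A ∨ C = B := by
  obtain ⟨A, B, -, h⟩ := Set.encard_eq_two.1 (R.point_mem_nodes x)
  refine ⟨A, B, fun C hC hx => ?_⟩
  have : C ∈ {C ∈ R.circles | R.point x ∈ C} := ⟨hC, hx⟩
  rwa [h] at this

theorem mem_nodes_of_two_circles {A B : PlaneCircle} (hA : A ∈ R.circles) (hB : B ∈ R.circles)
    (hAB : A ≠ B) {q : ℂ} (hqA : q ∈ A) (hqB : q ∈ B) : q ∈ nodes R.circles := by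
  refine le_antisymm (R.at_most_two q) ?_
  rw [← Set.encard_pair hAB]
  apply Set.encard_le_encard
  rintro C (rfl | rfl)
  · exact ⟨hA, hqA⟩
  · exact ⟨hB, hqB⟩

/-- At most two edges at a vertex lie on the same circle. -/
theorem not_three_on_circle {x : MVertex} {e f g : MEdge} (hef : e ≠ f) (heg : e ≠ g)
    (hfg : f ≠ g) (he : x ∈ mEnds e) (hf : x ∈ mEnds f) (hg : x ∈ mEnds g)
    (h1 : R.edgeCircle e = R.edgeCircle f) : R.edgeCircle f ≠ R.edgeCircle g := by
  intro h2
  obtain ⟨y, hy⟩ := he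
  obtain ⟨z, hz⟩ := hf
  obtain ⟨w, hw⟩ := hg
  have hC := R.edgeCircle_radius_pos g
  have a1 := R.arcOn_edgeCircle hy
  have a2 := R.arcOn_edgeCircle hz
  have a3 := R.arcOn_edgeCircle hw
  rw [h1, h2] at a1
  rw [h2] at a2
  have n1 : R.arc e ≠ R.arc f := R.arc_injective.ne hef
  have n2 : R.arc e ≠ R.arc g := R.arc_injective.ne heg
  have n3 : R.arc f ≠ R.arc g := R.arc_injective.ne hfg
  rcases a1 with a1 | a1 <;> rcases a2 with a2 | a2
  · exact n1 (a1.eq_of_left hC a2)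
  · rcases a3 with a3 | a3
    · exact n2 (a1.eq_of_left hC a3)
    · exact n3 (a2.eq_of_right hC a3)
  · rcases a3 with a3 | a3
    · exact n3 (a2.eq_of_left hC a3)
    · exact n2 (a1.eq_of_right hC a3)
  · exact n1 (a1.eq_of_right hC a2)

/-- The four edges at a vertex lie in pairs on two circles. -/
theorem edgeCircle_pairing {x : MVertex} {e f g h : MEdge} (hd : [e, f, g, h].Nodup)
    (he : x ∈ mEnds e) (hf : x ∈ mEnds f) (hg : x ∈ mEnds g) (hh : x ∈ mEnds h) :
    (R.edgeCircle e = R.edgeCircle f ∧ R.edgeCircle g = R.edgeCircle h ∧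
      R.edgeCircle e ≠ R.edgeCircle g) ∨
    (R.edgeCircle e = R.edgeCircle g ∧ R.edgeCircle f = R.edgeCircle h ∧
      R.edgeCircle e ≠ R.edgeCircle f) ∨
    (R.edgeCircle e = R.edgeCircle h ∧ R.edgeCircle f = R.edgeCircle g ∧
      R.edgeCircle e ≠ R.edgeCircle f) := by
  obtain ⟨A, B, hAB⟩ := R.exists_two_circles x
  have hmem : ∀ e, x ∈ mEnds e → R.edgeCircle e = A ∨ R.edgeCircle e = B := fun e ⟨y, hy⟩ =>
    hAB _ (R.edgeCircle_mem e) (R.point_mem_edgeCircle hy)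
  simp only [List.nodup_cons, List.mem_cons, List.not_mem_nil, or_false, not_or] at hd
  obtain ⟨⟨hef, heg, heh⟩, ⟨hfg, hfh⟩, hgh, -⟩ := hd
  have t1 := R.not_three_on_circle hef heg hfg he hf hg
  have t2 := R.not_three_on_circle hef heh hfh he hf hh
  have t3 := R.not_three_on_circle heg heh hgh he hg hh
  have t4 := R.not_three_on_circle hfg hfh hgh hf hg hh
  have m1 := hmem e he
  have m2 := hmem f hf
  have m3 := hmem g hg
  have m4 := hmem h hh
  clear hmem hAB he hf hg hh
  grind

theorem mem_mEnds_digon (i : Fin 8) (b : Bool) : MVertex.v i ∈ mEnds (.digon i b) :=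
  Sym2.mem_mk_left _ _

theorem mem_mEnds_digon_hub (i : Fin 8) (b : Bool) :
    MVertex.w (mHub i) ∈ mEnds (.digon i b) :=
  Sym2.mem_mk_right _ _

/-- The two edges of a digon form a circle. -/
theorem edgeCircle_digon (i : Fin 8) :
    R.edgeCircle (.digon i false) = R.edgeCircle (.digon i true) := by
  by_contra hne
  obtain ⟨j, hij, hj⟩ := exists_ne_mHub_eq i
  have hub : ∀ b, MVertex.w (mHub i) ∈ mEnds (.digon j b) := fun b =>
    hj ▸ mem_mEnds_digon_hub j b
  have pi : ∀ b, R.point (.v i) ∈ R.edgeCircle (.digon i b) := fun b =>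
    R.point_mem_edgeCircle (y := .w (mHub i)) rfl
  have pj : ∀ b, R.point (.v j) ∈ R.edgeCircle (.digon j b) := fun b =>
    R.point_mem_edgeCircle (y := .w (mHub j)) rfl
  have pw : ∀ b, R.point (.w (mHub i)) ∈ R.edgeCircle (.digon i b) := fun b =>
    R.point_mem_edgeCircle (y := .v i) Sym2.eq_swap
  have pj' : ∀ b, R.point (.v j) ∈ R.edgeCircle (.digon i b) := by
    rcases R.edgeCircle_pairing (x := .w (mHub i)) (e := .digon i false) (f := .digon i true)
      (g := .digon j false) (h := .digon j true) (by simp [hij]) (mem_mEnds_digon_hub i _)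
      (mem_mEnds_digon_hub i _) (hub _) (hub _) with ⟨h, -⟩ | ⟨h1, h2, -⟩ | ⟨h1, h2, -⟩
    · exact absurd h hne
    · rintro (_ | _)
      · rw [h1]; exact pj _
      · rw [h2]; exact pj _
    · rintro (_ | _)
      · rw [h1]; exact pj _
      · rw [h2]; exact pj _
  rcases EuclideanGeometry.eq_of_mem_sphere_of_mem_sphere_of_finrank_eq_two
    Complex.finrank_real_complex hne (R.point_injective.ne (by simpa using hij)) (pi false)
    (pj' false) (pw false) (pi true) (pj' true) (pw true) with h | h
  · simpa using R.point_injective h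
  · simpa using R.point_injective h

/-- The circle formed by a digon. -/
noncomputable def digonCircle (i : Fin 8) : PlaneCircle :=
  R.edgeCircle (.digon i false)

theorem point_hub_mem_digonCircle (i : Fin 8) : R.point (.w (mHub i)) ∈ R.digonCircle i :=
  R.point_mem_edgeCircle (y := .v i) Sym2.eq_swap

theorem point_mem_digonCircle (i : Fin 8) : R.point (.v i) ∈ R.digonCircle i :=
  R.point_mem_edgeCircle (y := .w (mHub i)) rfl

theorem eq_or_eq_of_point_mem_digonCircle {i : Fin 8} {x : MVertex}
    (h : R.point x ∈ R.digonCircle i) : x = .v i ∨ x = .w (mHub i) := by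
  have hC := R.edgeCircle_radius_pos (.digon i false)
  have hne : R.arc (.digon i false) ≠ R.arc (.digon i true) := R.arc_injective.ne (by simp)
  have a1 := R.arcOn_edgeCircle (e := .digon i false) rfl
  have a2 := R.arcOn_edgeCircle (e := .digon i true) rfl
  rw [← edgeCircle_digon] at a2
  rcases a1 with a1 | a1 <;> rcases a2 with a2 | a2
  · exact absurd (a1.eq_of_left hC a2) hne
  · exact (a1.eq_or_eq_of_two_arcs hC a2 h (R.point_mem_nodes x)).imp (R.point_injective ·)
      (R.point_injective ·)
  · exact (a2.eq_or_eq_of_two_arcs hC a1 h (R.point_mem_nodes x)).imp (R.point_injective ·)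
      (R.point_injective ·)
  · exact absurd (a1.eq_of_right hC a2) hne

theorem edgeCircle_cycle_succ (i : Fin 8) :
    R.edgeCircle (.cycle (i + 1)) = R.edgeCircle (.cycle i) := by
  rcases R.edgeCircle_pairing (x := .v (i + 1)) (e := .digon (i + 1) false)
    (f := .digon (i + 1) true) (g := .cycle (i + 1)) (h := .cycle i) (by simp)
    (mem_mEnds_digon _ _) (mem_mEnds_digon _ _) (Sym2.mem_mk_left _ _) (Sym2.mem_mk_right _ _)
    with ⟨-, h, -⟩ | ⟨-, -, h⟩ | ⟨-, -, h⟩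
  · exact h
  · exact absurd (R.edgeCircle_digon _) h
  · exact absurd (R.edgeCircle_digon _) h

end CircleRepresentation

/-- A property of `Fin 8` that is closed under cyclic successors holds everywhere or nowhere. -/
theorem Fin.forall_of_cyclic_succ {P : Fin 8 → Prop} (h : ∀ i, P i → P (i + 1)) {j : Fin 8}
    (hj : P j) (i : Fin 8) : P i := by
  have key : ∀ n : ℕ, P (j + Fin.ofNat 8 n) := by
    intro n
    induction n with
    | zero => simpa using hj
    | succ n ih =>
      rw [Fin.ofNat_eight_succ, ← add_assoc]
      exact h _ ih
  have := key (i - j).val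
  rwa [Fin.ofNat_val_eq_self, add_sub_cancel] at this

namespace CircleRepresentation

variable (R : CircleRepresentation multigraphM)

theorem edgeCircle_cycle (i : Fin 8) : R.edgeCircle (.cycle i) = R.edgeCircle (.cycle 0) :=
  Fin.forall_of_cyclic_succ (P := fun i => R.edgeCircle (.cycle i) = R.edgeCircle (.cycle 0))
    (fun i h => (R.edgeCircle_cycle_succ i).trans h) (j := 0) rfl i

theorem point_mem_cycleCircle (i : Fin 8) : R.point (.v i) ∈ R.edgeCircle (.cycle 0) := by
  rw [← R.edgeCircle_cycle i]
  exact R.point_mem_edgeCircle (y := .v (i + 1)) rfl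

theorem digonCircle_injective : Function.Injective R.digonCircle := by
  intro i j h
  have := R.point_mem_digonCircle j
  rw [← h] at this
  simpa [eq_comm] using R.eq_or_eq_of_point_mem_digonCircle this

theorem digonCircle_ne_cycleCircle (i : Fin 8) :
    R.digonCircle i ≠ R.edgeCircle (.cycle 0) := by
  intro h
  have := R.point_mem_cycleCircle (i + 1)
  rw [← h] at this
  simpa using R.eq_or_eq_of_point_mem_digonCircle this

theorem eq_of_mem_digonCircle_of_mem_digonCircle {i j : Fin 8} (hij : i ≠ j) {q : ℂ}
    (hi : q ∈ R.digonCircle i) (hj : q ∈ R.digonCircle j) :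
    mHub i = mHub j ∧ q = R.point (.w (mHub i)) := by
  obtain ⟨x, rfl⟩ := R.exists_point_eq (R.mem_nodes_of_two_circles (R.edgeCircle_mem _)
    (R.edgeCircle_mem _) (R.digonCircle_injective.ne hij) hi hj)
  rcases R.eq_or_eq_of_point_mem_digonCircle hi with rfl | rfl
  · exact absurd (R.eq_or_eq_of_point_mem_digonCircle hj) (by simp [hij])
  · exact ⟨by simpa using R.eq_or_eq_of_point_mem_digonCircle hj, rfl⟩

theorem eq_of_mem_cycleCircle_of_mem_digonCircle {i : Fin 8} {q : ℂ}
    (hC : q ∈ R.edgeCircle (.cycle 0)) (hi : q ∈ R.digonCircle i) : q = R.point (.v i) := by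
  obtain ⟨x, rfl⟩ := R.exists_point_eq (R.mem_nodes_of_two_circles (R.edgeCircle_mem _)
    (R.edgeCircle_mem _) (R.digonCircle_ne_cycleCircle i) hi hC)
  rcases R.eq_or_eq_of_point_mem_digonCircle hi with rfl | rfl
  · rfl
  · obtain ⟨j, hij, hj⟩ := exists_ne_mHub_eq i
    obtain ⟨A, B, h⟩ := R.exists_two_circles (.w (mHub i))
    have h1 := h _ (R.edgeCircle_mem _) hC
    have h2 := h _ (R.edgeCircle_mem _) hi
    have h3 := h _ (R.edgeCircle_mem _) (hj ▸ R.point_hub_mem_digonCircle j)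
    have n1 := R.digonCircle_ne_cycleCircle i
    have n2 := R.digonCircle_ne_cycleCircle j
    have n3 := R.digonCircle_injective.ne hij
    unfold digonCircle at *
    grind

/-- The eight arcs of the cycle have the same orientation. -/
theorem cycle_arcs_oriented :
    (∀ i, ArcOn (nodes R.circles) (R.edgeCircle (.cycle 0)) (R.arc (.cycle i))
      (R.point (.v i)) (R.point (.v (i + 1)))) ∨
    (∀ i, ArcOn (nodes R.circles) (R.edgeCircle (.cycle 0)) (R.arc (.cycle i))
      (R.point (.v (i + 1))) (R.point (.v i))) := by
  have hor := fun i => R.arcOn_edgeCircle (e := .cycle i) (x := .v i) (y := .v (i + 1)) rfl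
  simp only [R.edgeCircle_cycle] at hor
  by_cases h : ∃ i, ArcOn (nodes R.circles) (R.edgeCircle (.cycle 0)) (R.arc (.cycle i))
      (R.point (.v i)) (R.point (.v (i + 1)))
  · obtain ⟨j, hj⟩ := h
    left
    refine Fin.forall_of_cyclic_succ (fun i hi => (hor (i + 1)).resolve_right fun h => ?_) hj
    have := R.arc_injective (hi.eq_of_right (R.edgeCircle_radius_pos _) h)
    simp at this
  · push Not at h
    exact Or.inr fun i => (hor i).resolve_left (h i)

end CircleRepresentation

theorem mainTheorem2 : ¬ CircleRepresentable multigraphM := by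
  rintro ⟨R⟩
  have htan : ∀ i j, i ≠ j → mHub i = mHub j → R.digonCircle i ≠ R.digonCircle j ∧
      ∃ w, w ∈ R.digonCircle i ∧ w ∈ R.digonCircle j ∧
        ∀ q, q ∈ R.digonCircle i → q ∈ R.digonCircle j → q = w := fun i j hij h =>
    ⟨R.digonCircle_injective.ne hij, R.point (.w (mHub i)), R.point_hub_mem_digonCircle i,
      h ▸ R.point_hub_mem_digonCircle j, fun q hi hj =>
        (R.eq_of_mem_digonCircle_of_mem_digonCircle hij hi hj).2⟩
  have hdis : ∀ i j, mHub i ≠ mHub j → ∀ q, q ∈ R.digonCircle i → q ∉ R.digonCircle j :=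
    fun i j h q hi hj => h (R.eq_of_mem_digonCircle_of_mem_digonCircle
      (fun hij => h (congrArg mHub hij)) hi hj).1
  have hv : Function.Injective fun i => R.point (.v i) := fun i j h =>
    MVertex.v.inj (R.point_injective h)
  have hC := R.edgeCircle_radius_pos (.cycle 0)
  have hD : ∀ i, 0 < (R.digonCircle i).radius := fun i => R.edgeCircle_radius_pos _
  rcases R.cycle_arcs_oriented with h | h
  · exact mHub_contacts_false hC hD R.digonCircle_ne_cycleCircle hv h R.point_mem_digonCircle
      (fun i q => R.eq_of_mem_cycleCircle_of_mem_digonCircle) htan hdis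
  · have hub : ∀ i j : Fin 8, mHub i.rev = mHub j.rev ↔ mHub i = mHub j := by decide
    have hrev : ∀ i : Fin 8, (i + 1).rev + 1 = i.rev := by decide
    refine mHub_contacts_false (N := nodes R.circles) (D := fun i => R.digonCircle i.rev)
      (v := fun i => R.point (.v i.rev)) (B := fun i => R.arc (.cycle (i + 1).rev)) hC
      (fun i => hD _) (fun i => R.digonCircle_ne_cycleCircle _) (hv.comp Fin.rev_injective)
      (fun i => ?_) (fun i => R.point_mem_digonCircle _)
      (fun i q => R.eq_of_mem_cycleCircle_of_mem_digonCircle)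
      (fun i j hij hh => htan _ _ (Fin.rev_injective.ne hij) ((hub i j).2 hh))
      (fun i j hh => hdis _ _ (mt (hub i j).1 hh))
    have := h (i + 1).rev
    rwa [hrev] at this
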